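/- Let $\mathfrak C$ be a monster model of a first-order theory in a language $L$, i.e. $\mathfrak C$ is $\kappa$-saturated and strongly $\kappa$-homogeneous for some uncountable strong limit cardinal $\kappa>|L|$; "small" and "bounded" mean "of cardinality $<\kappa$". Let $A\subseteq\mathfrak C$ be small and let $H\subseteq\mathfrak C^m$ be a group definable over $A$ (its underlying set and its multiplication are definable with parameters from $A$). Assume: - $H$ is absolutely connected: $H$ has no proper type-definable (over a small set) subgroup of bounded index; - $H$ has fsg: there are a complete type $q$ over $\mathfrak C$ containing the formula defining $H$ and a small model $M\prec\mathfrak C$ such that for every $g\in H$ the translate $gq$ is finitely satisfiable in $M$. Call a complete type over $\mathfrak C$ containing the formula defining $H$ generic if for every formula $\varphi$ in it, finitely many left translates of $\varphi(\mathfrak C)\cap H$ cover $H$. Then $H$ has exactly one global generic type $p$, this $p$ is invariant over $A$, and for every integer $n\ge 1$ each element of $\Gamma_n(H)$ is a (finite) product of conjugates in $H$ of elements of the set $$\{\gamma_n(g_0,\dots,g_{n-1}) : (g_0,\dots,g_{n-1})\models p^{(n)}|A\}.$$ Here $[x,y]=x^{-1}y^{-1}xy$; $\gamma_1(h_0)=h_0$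 and $\gamma_{n+1}(h_0,\dots,h_n)=[\gamma_n(h_0,\dots,h_{n-1}),h_n]$; $\Gamma_1(H)=H$ and $\Gamma_{n+1}(H)=[\Gamma_n(H),H]$ is the lower central series; a Morley sequence in $p$ over a small $C\supseteq A$ is a sequence $(a_i)$ such that $a_i\models p|C a_{<i}$ for all $i$; and $p^{(n)}$ is the complete type over $\mathfrak C$ whose restriction to each small $C\supseteq A$ is the (unique) type over $C$ of a Morley sequence in $p$ over $C$ of length $n$. -/

import Mathlib

open FirstOrder FirstOrder.Language Cardinal

universe u v w

namespace MonsterGroup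

section Basic

variable {L : FirstOrder.Language.{u, v}} {M : Type w} [L.Structure M]

/-- Two tuples of `M` have the same type over `A`. -/
def SameTypeOver (L : FirstOrder.Language.{u, v}) {M : Type w} [L.Structure M] {k : ℕ} (A : Set M)
    (c c' : Fin k → M) : Prop :=
  ∀ ψ : L[[A]].Formula (Fin k), ψ.Realize c ↔ ψ.Realize c'

/-- `M` is `κ`-saturated: a set of formulas in finitely many variables, over fewer than `κ`
parameters, which is finitely satisfiable in `M`, is realized in `M`. -/
def IsSaturated (L : FirstOrder.Language.{u, v}) (M : Type w) [L.Structure M]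
    (κ : Cardinal.{w}) : Prop :=
  ∀ (B : Set M), #B < κ → ∀ (k : ℕ) (S : Set (L[[B]].Formula (Fin k))),
    (∀ F : Finset (L[[B]].Formula (Fin k)), (F : Set (L[[B]].Formula (Fin k))) ⊆ S →
      ∃ a : Fin k → M, ∀ φ ∈ F, φ.Realize a) →
    ∃ a : Fin k → M, ∀ φ ∈ S, φ.Realize a

/-- `M` is strongly `κ`-homogeneous: a partial elementary map of `M` whose domain has fewer than
`κ` elements extends to an automorphism of `M`. -/
def IsStronglyHomogeneous (L : FirstOrder.Language.{u, v}) (M : Type w) [L.Structure M]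
    (κ : Cardinal.{w}) : Prop :=
  ∀ (B : Set M), #B < κ → ∀ f : B → M,
    (∀ φ : L.Formula B, φ.Realize (fun b : B => (b : M)) ↔ φ.Realize f) →
    ∃ σ : M ≃[L] M, ∀ b : B, σ b = f b

/-- `M` is a monster model with degree of saturation `κ`, where `κ` is an uncountable strong limit
cardinal larger than the cardinality of the language.  "Small" and "bounded" mean
"of cardinality less than `κ`". -/
structure IsMonster (L : FirstOrder.Language.{u, v}) (M : Type w) [L.Structure M]
    (κ : Cardinal.{w}) : Prop where
  aleph0_lt : ℵ₀ < κ
  strongLimit : κ.IsStrongLimit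
  card_lt : Cardinal.lift.{w} L.card < Cardinal.lift.{max u v} κ
  saturated : IsSaturated L M κ
  homogeneous : IsStronglyHomogeneous L M κ

/-- Complete types over the whole of `M`, in the variables `α`. -/
abbrev GlobalType (L : FirstOrder.Language.{u, v}) (M : Type w) [L.Structure M] (α : Type) :=
  (L[[M]].completeTheory M).CompleteType α

/-- The set of formulas, with parameters from `M`, which belong to a global type. -/
def GlobalType.formulas {α : Type} (p : GlobalType L M α) : Set (L[[M]].Formula α) :=
  {φ | Formula.equivSentence φ ∈ p}

/-- The set `X` is defined by a formula that belongs to `p`. -/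
def GlobalType.Contains {α : Type} (p : GlobalType L M α) (X : Set (α → M)) : Prop :=
  ∃ φ ∈ p.formulas, {x : α → M | φ.Realize x} = X

/-- `a` realizes the restriction to `B` of a set `S` of formulas with parameters from `M`. -/
def RealizesOver {α : Type} (S : Set (L[[M]].Formula α)) (B : Set M) (a : α → M) : Prop :=
  ∀ φ : L[[B]].Formula α,
    (L.lhomWithConstantsMap (fun b : B => (b : M))).onFormula φ ∈ S → φ.Realize a

/-- The set `S` of formulas is finitely satisfiable in the subset `N` of `M`. -/
def FinitelySatisfiableIn {α : Type} (S : Set (L[[M]].Formula α)) (N : Set M) : Prop :=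
  ∀ F : Finset (L[[M]].Formula α), (F : Set (L[[M]].Formula α)) ⊆ S →
    ∃ a : α → M, (∀ i, a i ∈ N) ∧ ∀ φ ∈ F, φ.Realize a

/-- `p` is invariant over `A`: whether `φ(x, c)` belongs to `p` depends only on `φ` and on the type
of `c` over `A`. -/
def GlobalType.IsInvariantOver {α : Type} (p : GlobalType L M α) (A : Set M) : Prop :=
  ∀ (k : ℕ) (φ : L.Formula (α ⊕ Fin k)) (c c' : Fin k → M), SameTypeOver L A c c' →
    (p.Contains {x | φ.Realize (Sum.elim x c)} ↔ p.Contains {x | φ.Realize (Sum.elim x c')})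

/-- `(a 0, …, a (n - 1))` is a Morley sequence in `p` over `A`: each `a i` realizes the restriction
of `p` to `A` together with the coordinates of the `a j` with `j < i`. -/
def GlobalType.IsMorleySequence {m n : ℕ} (p : GlobalType L M (Fin m)) (A : Set M)
    (a : Fin n → Fin m → M) : Prop :=
  ∀ i, RealizesOver p.formulas (A ∪ {b | ∃ j < i, ∃ t, b = a j t}) (a i)

/-- The power `p^{(n)}` of a global type `p` invariant over the small set `A`, as a set of formulas
over `M`.  All Morley sequences in `p` of length `n` over a small set `C ⊇ A` have the same type
over `C`, and `p^{(n)}` is the complete type over `M` whose restriction to each such `C` is that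
type.  So a formula belongs to it if and only if it holds of the Morley sequences over `A ∪ B` as
soon as the finite set `B` is large enough (containing the parameters of the formula). -/
def GlobalType.power {m : ℕ} (p : GlobalType L M (Fin m)) (A : Set M) (n : ℕ) :
    Set (L[[M]].Formula (Fin n × Fin m)) :=
  {φ | ∃ B : Set M, B.Finite ∧ ∀ a : Fin n → Fin m → M,
    p.IsMorleySequence (A ∪ B) a → φ.Realize (fun t => a t.1 t.2)}

end Basic

section Group

variable (L : FirstOrder.Language.{u, v}) {M : Type w} [L.Structure M] {m : ℕ}
  (H : Set (Fin m → M)) [Group H]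

/-- The group `H` is definable over `A`: so are its underlying set and the graph of its
multiplication. -/
structure IsDefinableGroup (A : Set M) : Prop where
  carrier : A.Definable L H
  mul : A.Definable L {z : Fin 3 × Fin m → M | ∃ x y : H,
    (fun i => z (0, i)) = (x : Fin m → M) ∧ (fun i => z (1, i)) = (y : Fin m → M) ∧
      (fun i => z (2, i)) = ((x * y : H) : Fin m → M)}

/-- The subgroup `K` of `H` is type-definable: it is defined by a set of formulas over a small set
of parameters. -/
def IsTypeDefinable (κ : Cardinal.{w}) (K : Subgroup H) : Prop :=
  ∃ B : Set M, #B < κ ∧ ∃ S : Set (L[[B]].Formula (Fin m)),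
    ∀ x : Fin m → M, (∃ hx : x ∈ H, (⟨x, hx⟩ : H) ∈ K) ↔ ∀ φ ∈ S, φ.Realize x

/-- `H` has no proper type-definable subgroup of bounded index. -/
def IsAbsolutelyConnected (κ : Cardinal.{w}) : Prop :=
  ∀ K : Subgroup H, IsTypeDefinable L H κ K → #(H ⧸ K) < κ → K = ⊤

/-- The translate `g p` of a global type `p` containing `H`: the formula `φ(x)` belongs to `g p`
if and only if `φ(g * x)` belongs to `p`. -/
def translate (g : H) (p : GlobalType L M (Fin m)) : Set (L[[M]].Formula (Fin m)) :=
  {φ | p.Contains {x | ∃ hx : x ∈ H, φ.Realize ((g * ⟨x, hx⟩ : H) : Fin m → M)}}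

/-- `H` has finitely satisfiable generics: there are a global type `p` containing `H` and a small
elementary substructure `N` of `M` such that every translate of `p` is finitely satisfiable
in `N`. -/
def HasFSG (κ : Cardinal.{w}) : Prop :=
  ∃ p : GlobalType L M (Fin m), p.Contains H ∧
    ∃ N : L.ElementarySubstructure M, #N < κ ∧
      ∀ g : H, FinitelySatisfiableIn (translate L H g p) (N : Set M)

/-- Finitely many left translates of the trace of `X` on `H` cover `H`. -/
def IsLeftGeneric (X : Set (Fin m → M)) : Prop :=
  ∃ F : Finset H, ∀ h : H, ∃ f ∈ F, ∃ x : H, (x : Fin m → M) ∈ X ∧ h = f * x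

/-- `p` is a global generic type of `H`. -/
def IsGenericType (p : GlobalType L M (Fin m)) : Prop :=
  p.Contains H ∧ ∀ φ ∈ p.formulas, IsLeftGeneric H {x | φ.Realize x}

end Group

/-- The iterated commutator of `n + 1` elements, that is, `γ_{n+1}(g 0, …, g n)`, where
`γ_1(h) = h`, `γ_{n+1}(h_0, …, h_n) = [γ_n(h_0, …, h_{n-1}), h_n]` and
`[x, y] = x⁻¹ y⁻¹ x y`. -/
def iteratedCommutator {G : Type*} [Group G] : (n : ℕ) → (Fin (n + 1) → G) → G
  | 0, g => g 0
  | n + 1, g =>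
    (iteratedCommutator n fun i => g i.castSucc)⁻¹ * (g (Fin.last (n + 1)))⁻¹ *
      (iteratedCommutator n fun i => g i.castSucc) * g (Fin.last (n + 1))

end MonsterGroup

/-!
Write "generic" for left generic. By saturation, the translates of an fsg type `p` being finitely
satisfiable in a small `N` forces every definable set in `p` to be generic, and genericity of a
definable set to be the same on the left and on the right. The definable sets that are not generic
then form an ideal all of whose members are avoided by `p`. The stabilizer of a definable set
modulo this ideal is type-definable, and of bounded index because a coset of it is determined by
the trace of the corresponding translate on `N`; by connectedness it is the whole group. As a
generic set has a translate in `p`, it is itself in `p`: so `p` consists exactly of the generic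
sets, which makes it unique, invariant over `A`, and closed under left translation and inversion.

Given `x` and a small set `C`, take `a` realizing `p` over `C` and `x`. Then `a⁻¹ * x` also
realizes `p` over `C`, so `x` is a product of two realizations of `p` over `C`. The identity
`[x, a * b] = [x, b] * [x, a] ^ b` and induction along the lower central series, with `C` the set
of coordinates of the Morley sequence obtained so far, give the commutator statement.
-/

open scoped Pointwise symmDiff

namespace MonsterGroup

section Syndetic

variable {G : Type*} [Group G] {X Y : Set G}

/-- Finitely many left translates of `X` cover the group. -/
def IsLeftSyndetic (X : Set G) : Prop :=
  ∃ F : Finset G, ∀ h, ∃ f ∈ F, h ∈ f • X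

theorem isLeftSyndetic_iff_exists_fin :
    IsLeftSyndetic X ↔ ∃ k, ∃ g : Fin k → G, ∀ h, ∃ i, h ∈ g i • X := by
  constructor
  · rintro ⟨F, hF⟩
    refine ⟨F.card, fun i => F.equivFin.symm i, fun h => ?_⟩
    obtain ⟨f, hf, hx⟩ := hF h
    exact ⟨F.equivFin ⟨f, hf⟩, by simpa using hx⟩
  · classical
    rintro ⟨k, g, hg⟩
    exact ⟨Finset.univ.image g, fun h => by simpa using hg h⟩

theorem mem_smul_inv_iff {a b : G} : a ∈ b • X⁻¹ ↔ b ∈ a • X := by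
  simp only [Set.mem_smul_set_iff_inv_smul_mem, Set.mem_inv, smul_eq_mul, mul_inv_rev, inv_inv]

theorem isLeftSyndetic_inv_iff :
    IsLeftSyndetic X⁻¹ ↔ ∃ F : Finset G, ∀ g : G, (g • X ∩ F).Nonempty := by
  refine exists_congr fun F => forall_congr' fun g => exists_congr fun f => ?_
  rw [mem_smul_inv_iff, Set.mem_inter_iff, SetLike.mem_coe, and_comm]

theorem IsLeftSyndetic.mono (hX : IsLeftSyndetic X) (hXY : X ⊆ Y) : IsLeftSyndetic Y :=
  hX.imp fun _ hF h => (hF h).imp fun _ => And.imp_right fun hh => Set.smul_set_mono hXY hh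

theorem IsLeftSyndetic.nonempty (hX : IsLeftSyndetic X) : X.Nonempty := by
  obtain ⟨F, hF⟩ := hX
  obtain ⟨f, -, x, hx, -⟩ := hF 1
  exact ⟨x, hx⟩

theorem IsLeftSyndetic.smul (hX : IsLeftSyndetic X) (g : G) : IsLeftSyndetic (g • X) := by
  classical
  obtain ⟨F, hF⟩ := hX
  refine ⟨F.image (· * g⁻¹), fun h => ?_⟩
  obtain ⟨f, hf, hh⟩ := hF h
  exact ⟨f * g⁻¹, Finset.mem_image_of_mem _ hf, by simpa [smul_smul] using hh⟩

theorem isLeftSyndetic_smul_iff (g : G) : IsLeftSyndetic (g • X) ↔ IsLeftSyndetic X :=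
  ⟨fun h => by simpa using h.smul g⁻¹, fun h => h.smul g⟩

theorem IsLeftSyndetic.exists_smul_mem (hX : IsLeftSyndetic X) (𝒰 : Ultrafilter G) :
    ∃ g : G, g • X ∈ 𝒰 := by
  obtain ⟨F, hF⟩ := hX
  have hcover : ⋃ f ∈ (F : Set G), f • X ∈ 𝒰 :=
    Filter.mem_of_superset Filter.univ_mem fun h _ => by simpa using hF h
  obtain ⟨g, -, hg⟩ := (Ultrafilter.finite_biUnion_mem_iff F.finite_toSet).1 hcover
  exact ⟨g, hg⟩

end Syndetic

section FSG

variable {G : Type*} [Group G]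

/-- An abstract form of finitely satisfiable generics for the Boolean algebra `D` of definable
subsets of `G`: the members of `D` that have a translate in `𝒰` meet the small set `N`.  The last
field is what saturation contributes. -/
structure IsFSG (D : BooleanSubalgebra (Set G)) (𝒰 : Ultrafilter G) (N : Set G) : Prop where
  smul_mem : ∀ (g : G) {X : Set G}, X ∈ D → g • X ∈ D
  inv_mem : ∀ {X : Set G}, X ∈ D → X⁻¹ ∈ D
  inter_nonempty : ∀ {X : Set G} {g : G}, X ∈ D → g • X ∈ 𝒰 → (X ∩ N).Nonempty
  exists_finset : ∀ {X : Set G}, X ∈ D → (∀ g : G, (g • X ∩ N).Nonempty) →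
    ∃ F : Finset G, ∀ g : G, (g • X ∩ F).Nonempty

namespace IsFSG

variable {D : BooleanSubalgebra (Set G)} {𝒰 : Ultrafilter G} {N X Y : Set G}

theorem inter_nonempty_of_isLeftSyndetic (h𝒰 : IsFSG D 𝒰 N) (hX : X ∈ D)
    (hsynd : IsLeftSyndetic X) : (X ∩ N).Nonempty := by
  obtain ⟨g, hg⟩ := hsynd.exists_smul_mem 𝒰
  exact h𝒰.inter_nonempty hX hg

theorem isLeftSyndetic_inv (h𝒰 : IsFSG D 𝒰 N) (hX : X ∈ D) (hsynd : IsLeftSyndetic X) :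
    IsLeftSyndetic X⁻¹ :=
  isLeftSyndetic_inv_iff.2 <| h𝒰.exists_finset hX fun g =>
    h𝒰.inter_nonempty_of_isLeftSyndetic (h𝒰.smul_mem g hX) (hsynd.smul g)

theorem isLeftSyndetic_of_mem (h𝒰 : IsFSG D 𝒰 N) (hX : X ∈ D) (hmem : X ∈ 𝒰) :
    IsLeftSyndetic X := by
  have hinv : IsLeftSyndetic X⁻¹ := isLeftSyndetic_inv_iff.2 <| h𝒰.exists_finset hX fun g =>
    h𝒰.inter_nonempty (g := g⁻¹) (h𝒰.smul_mem g hX) (by rwa [inv_smul_smul])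
  simpa using h𝒰.isLeftSyndetic_inv (h𝒰.inv_mem hX) hinv

theorem isLeftSyndetic_iff_exists_smul_mem (h𝒰 : IsFSG D 𝒰 N) (hX : X ∈ D) :
    IsLeftSyndetic X ↔ ∃ g : G, g • X ∈ 𝒰 :=
  ⟨fun h => h.exists_smul_mem 𝒰, fun ⟨g, hg⟩ =>
    (isLeftSyndetic_smul_iff g).1 (h𝒰.isLeftSyndetic_of_mem (h𝒰.smul_mem g hX) hg)⟩

theorem isLeftSyndetic_or_of_union (h𝒰 : IsFSG D 𝒰 N) (hX : X ∈ D) (hY : Y ∈ D)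
    (hXY : IsLeftSyndetic (X ∪ Y)) : IsLeftSyndetic X ∨ IsLeftSyndetic Y := by
  obtain ⟨g, hg⟩ := hXY.exists_smul_mem 𝒰
  rw [Set.smul_set_union, Ultrafilter.union_mem_iff] at hg
  exact hg.imp (fun h => (h𝒰.isLeftSyndetic_iff_exists_smul_mem hX).2 ⟨g, h⟩)
    fun h => (h𝒰.isLeftSyndetic_iff_exists_smul_mem hY).2 ⟨g, h⟩

theorem symmDiff_mem (h𝒰 : IsFSG D 𝒰 N) (hX : X ∈ D) (g h : G) : (g • X) ∆ (h • X) ∈ D :=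
  D.sup_mem (D.sdiff_mem (h𝒰.smul_mem g hX) (h𝒰.smul_mem h hX))
    (D.sdiff_mem (h𝒰.smul_mem h hX) (h𝒰.smul_mem g hX))

/-- The stabilizer of `X` modulo the ideal of sets that are not left syndetic. -/
def stabilizer (h𝒰 : IsFSG D 𝒰 N) (hX : X ∈ D) : Subgroup G where
  carrier := {g | ¬ IsLeftSyndetic (X ∆ (g • X))}
  one_mem' h := by simpa using h.nonempty
  mul_mem' {g h} hg hh hgh := by
    have hcover : IsLeftSyndetic (X ∆ (g • X) ∪ g • (X ∆ (h • X))) := hgh.mono <| by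
      rw [Set.smul_set_symmDiff, smul_smul]
      exact symmDiff_triangle X (g • X) ((g * h) • X)
    have hD (k : G) : X ∆ (k • X) ∈ D := by simpa using h𝒰.symmDiff_mem hX 1 k
    rcases h𝒰.isLeftSyndetic_or_of_union (hD g) (h𝒰.smul_mem g (hD h)) hcover with h | h
    · exact hg h
    · exact hh ((isLeftSyndetic_smul_iff g).1 h)
  inv_mem' {g} hg hginv := hg <| by
    simpa [Set.smul_set_symmDiff, symmDiff_comm] using hginv.smul g

theorem mem_stabilizer_iff (h𝒰 : IsFSG D 𝒰 N) (hX : X ∈ D) {g : G} :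
    g ∈ h𝒰.stabilizer hX ↔ ¬ IsLeftSyndetic (X ∆ (g • X)) :=
  Iff.rfl

/-- The coset of `g` is determined by the trace of `g • X` on `N`. -/
theorem mk_quotient_stabilizer_le (h𝒰 : IsFSG D 𝒰 N) (hX : X ∈ D) :
    #(G ⧸ h𝒰.stabilizer hX) ≤ 2 ^ #N := by
  rw [← mk_set]
  refine mk_le_of_injective (f := fun a => {n : N | (n : G) ∈ a.out • X}) fun a b hab => ?_
  rw [← a.out_eq', ← b.out_eq', QuotientGroup.eq, mem_stabilizer_iff]
  intro hsynd
  have hsynd' : IsLeftSyndetic ((a.out • X) ∆ (b.out • X)) := by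
    simpa [Set.smul_set_symmDiff, smul_smul] using hsynd.smul a.out
  obtain ⟨n, hn, hnN⟩ :=
    h𝒰.inter_nonempty_of_isLeftSyndetic (h𝒰.symmDiff_mem hX _ _) hsynd'
  have : n ∈ a.out • X ↔ n ∈ b.out • X := Set.ext_iff.1 hab ⟨n, hnN⟩
  simp [Set.mem_symmDiff, this] at hn

theorem mem_iff_isLeftSyndetic (h𝒰 : IsFSG D 𝒰 N) (hX : X ∈ D)
    (hstab : h𝒰.stabilizer hX = ⊤) : X ∈ 𝒰 ↔ IsLeftSyndetic X := by
  refine ⟨h𝒰.isLeftSyndetic_of_mem hX, fun hsynd => ?_⟩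
  obtain ⟨g, hg⟩ := hsynd.exists_smul_mem 𝒰
  have hdiff : ¬ IsLeftSyndetic (X ∆ (g • X)) := (h𝒰.mem_stabilizer_iff hX).1 (hstab ▸ trivial)
  by_contra hX𝒰
  refine hdiff (h𝒰.isLeftSyndetic_of_mem (by simpa using h𝒰.symmDiff_mem hX 1 g) ?_)
  filter_upwards [hg, Ultrafilter.compl_mem_iff_notMem.2 hX𝒰] with x hxg hx
  exact .inr ⟨hxg, hx⟩

end IsFSG

end FSG

section Commutators

variable {G : Type*} [Group G] {S T : Set G} {x : G}

/-- The submonoid of finite products of conjugates of elements of `S`. -/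
def conjProducts (S : Set G) : Submonoid G :=
  Submonoid.closure (Group.conjugatesOfSet S)

theorem mem_conjugatesOfSet_iff_exists_inv_mul_mul :
    x ∈ Group.conjugatesOfSet S ↔ ∃ c : G, ∃ s ∈ S, x = c⁻¹ * s * c := by
  simp only [Group.mem_conjugatesOfSet_iff, isConj_iff]
  constructor
  · rintro ⟨s, hs, c, rfl⟩
    exact ⟨c⁻¹, s, hs, by simp⟩
  · rintro ⟨c, s, hs, rfl⟩
    exact ⟨s, hs, c⁻¹, by simp⟩

theorem subset_conjProducts : S ⊆ conjProducts S :=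
  Group.subset_conjugatesOfSet.trans Submonoid.subset_closure

theorem exists_list_of_mem_conjProducts (hx : x ∈ conjProducts S) :
    ∃ l : List G, l.prod = x ∧ ∀ y ∈ l, ∃ c : G, ∃ s ∈ S, y = c⁻¹ * s * c := by
  obtain ⟨l, hl, rfl⟩ := Submonoid.exists_list_of_mem_closure hx
  exact ⟨l, rfl, fun y hy => mem_conjugatesOfSet_iff_exists_inv_mul_mul.1 (hl y hy)⟩

theorem inv_mul_mul_mem_conjProducts (hx : x ∈ conjProducts S) (c : G) :
    c⁻¹ * x * c ∈ conjProducts S := by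
  induction hx using Submonoid.closure_induction with
  | mem x hx =>
    refine Submonoid.subset_closure ?_
    simpa using Group.conj_mem_conjugatesOfSet (c := c⁻¹) hx
  | one => simp
  | mul x y _ _ ihx ihy => simpa [mul_assoc] using mul_mem ihx ihy

theorem commutator_mem_conjProducts
    (hST : ∀ s ∈ S, ∀ h : G, s⁻¹ * h⁻¹ * s * h ∈ conjProducts T) (hx : x ∈ conjProducts S) :
    ∀ h : G, x⁻¹ * h⁻¹ * x * h ∈ conjProducts T := by
  induction hx using Submonoid.closure_induction with
  | mem x hx =>
    obtain ⟨c, s, hs, rfl⟩ := mem_conjugatesOfSet_iff_exists_inv_mul_mul.1 hx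
    intro h
    have := inv_mul_mul_mem_conjProducts (hST s hs (c * h * c⁻¹)) c
    simpa [mul_assoc] using this
  | one => simp
  | mul x y _ _ ihx ihy =>
    intro h
    have := mul_mem (inv_mul_mul_mem_conjProducts (ihx h) y) (ihy h)
    simpa [mul_assoc] using this

/-- `[x, a * b] = [x, b] * [x, a] ^ b`. -/
theorem commutator_mul_mem_conjProducts {a b : G} (ha : x⁻¹ * a⁻¹ * x * a ∈ conjProducts T)
    (hb : x⁻¹ * b⁻¹ * x * b ∈ conjProducts T) :
    x⁻¹ * (a * b)⁻¹ * x * (a * b) ∈ conjProducts T := by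
  simpa [mul_assoc] using mul_mem hb (inv_mul_mul_mem_conjProducts ha b)

theorem mem_conjProducts_of_mem_commutator {K : Subgroup G}
    (hKT : ∀ k ∈ K, ∀ h : G, k⁻¹ * h⁻¹ * k * h ∈ conjProducts T) (hx : x ∈ ⁅K, (⊤ : Subgroup G)⁆) :
    x ∈ conjProducts T := by
  have hle : ⁅K, (⊤ : Subgroup G)⁆.toSubmonoid ≤ conjProducts T := by
    rw [Subgroup.commutator_def, Subgroup.closure_toSubmonoid, Submonoid.closure_le,
      Set.union_subset_iff]
    constructor
    · rintro _ ⟨k, hk, h, -, rfl⟩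
      simpa [commutatorElement_def] using hKT k⁻¹ (inv_mem hk) h⁻¹
    · rintro y ⟨k, hk, h, -, hy⟩
      have := inv_mul_mul_mem_conjProducts (hKT k hk h⁻¹) k⁻¹
      rw [← inv_inv y, ← hy]
      simpa [commutatorElement_def, mul_assoc] using this
  exact hle hx

theorem mem_conjProducts_of_mem_lowerCentralSeries {S : (n : ℕ) → Set (Fin n → G)}
    (hzero : (S 0).Nonempty)
    (hsucc : ∀ n, ∀ g ∈ S n, ∀ h, ∃ a b, a * b = h ∧
      (Fin.snoc g a : Fin (n + 1) → G) ∈ S (n + 1) ∧ (Fin.snoc g b : Fin (n + 1) → G) ∈ S (n + 1))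
    {n : ℕ} (hx : x ∈ (⊤ : Subgroup G).lowerCentralSeries n) :
    x ∈ conjProducts (iteratedCommutator n '' S (n + 1)) := by
  induction n generalizing x with
  | zero =>
    obtain ⟨g, hg⟩ := hzero
    obtain ⟨a, b, rfl, ha, hb⟩ := hsucc 0 g hg x
    exact mul_mem (subset_conjProducts ⟨_, ha, rfl⟩) (subset_conjProducts ⟨_, hb, rfl⟩)
  | succ n ih =>
    rw [Subgroup.lowerCentralSeries_succ] at hx
    refine mem_conjProducts_of_mem_commutator
      (fun k hk => commutator_mem_conjProducts ?_ (ih hk)) hx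
    rintro _ ⟨g, hg, rfl⟩ h
    have hsnoc {a : G} (ha : (Fin.snoc g a : Fin (n + 2) → G) ∈ S (n + 2)) :
        (iteratedCommutator n g)⁻¹ * a⁻¹ * iteratedCommutator n g * a ∈
          conjProducts (iteratedCommutator (n + 1) '' S (n + 2)) :=
      subset_conjProducts ⟨_, ha, by simp [iteratedCommutator]⟩
    obtain ⟨a, b, rfl, ha, hb⟩ := hsucc (n + 1) g hg h
    exact commutator_mul_mem_conjProducts (hsnoc ha) (hsnoc hb)

end Commutators

section Types

variable {L : FirstOrder.Language.{u, v}} {M : Type w} [L.Structure M] {A B C : Set M}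

instance lhomWithConstantsMap_val_isExpansionOn :
    (L.lhomWithConstantsMap ((↑) : B → M)).IsExpansionOn M :=
  haveI : (LHom.constantsOnMap ((↑) : B → M)).IsExpansionOn M := constantsOnMap_isExpansionOn rfl
  LHom.sumMap_isExpansionOn _ _ _

instance lhomWithConstantsMap_univ_symm_isExpansionOn :
    (L.lhomWithConstantsMap (Equiv.Set.univ M).symm).IsExpansionOn M :=
  haveI : (LHom.constantsOnMap (Equiv.Set.univ M).symm).IsExpansionOn M :=
    constantsOnMap_isExpansionOn rfl
  LHom.sumMap_isExpansionOn _ _ _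

theorem definable_univ_iff {α : Type*} {X : Set (α → M)} :
    (Set.univ : Set M).Definable L X ↔ ∃ φ : L[[M]].Formula α, {x | φ.Realize x} = X := by
  constructor
  · rintro ⟨φ, rfl⟩
    exact ⟨(L.lhomWithConstantsMap (Subtype.val (p := (· ∈ (Set.univ : Set M))))).onFormula φ,
      by simp only [LHom.realize_onFormula]⟩
  · rintro ⟨φ, rfl⟩
    exact ⟨(L.lhomWithConstantsMap (Equiv.Set.univ M).symm).onFormula φ,
      by simp⟩

theorem SameTypeOver.mem_iff {k : ℕ} {c c' : Fin k → M} (h : SameTypeOver L A c c')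
    {X : Set (Fin k → M)} (hX : A.Definable L X) : c ∈ X ↔ c' ∈ X := by
  obtain ⟨ψ, rfl⟩ := hX
  exact h ψ

theorem exists_realize_of_model_completeTheory {W α : Type*} [Finite α] [L.Structure W]
    [W ⊨ L.completeTheory M] {φ : L.Formula α} {v : α → W} (hφ : φ.Realize v) :
    ∃ x : α → M, φ.Realize x := by
  let χ : L.Sentence := Formula.iExs α (φ.relabel (Sum.inr : α → Empty ⊕ α))
  have hW : W ⊨ χ := by
    simp only [χ, Sentence.Realize, Formula.realize_iExs, Formula.realize_relabel]
    exact ⟨v, hφ⟩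
  have hM : M ⊨ χ := (realize_iff_of_model_completeTheory M W χ).1 hW
  simpa [χ, Sentence.Realize, Formula.realize_iExs, Formula.realize_relabel] using hM

theorem IsSaturated.nonempty_iInter {κ : Cardinal.{w}} (hM : IsSaturated L M κ) (hB : #B < κ)
    {α ι : Type*} [Finite α] {X : ι → Set (α → M)} (hX : ∀ i, B.Definable L (X i))
    (hfip : ∀ F : Finset ι, (⋂ i ∈ F, X i).Nonempty) : (⋂ i, X i).Nonempty := by
  classical
  obtain ⟨k, ⟨e⟩⟩ := Finite.exists_equiv_fin α
  choose φ hφ using hX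
  have hrealize (i : ι) (a : Fin k → M) : ((φ i).relabel e).Realize a ↔ a ∘ e ∈ X i := by
    rw [Formula.realize_relabel, hφ i, Set.mem_ofPred_eq]
  obtain ⟨a, ha⟩ := hM B hB k (Set.range fun i => (φ i).relabel e) fun F hF => by
    rw [← Set.image_univ] at hF
    obtain ⟨F, -, rfl⟩ := Finset.subset_set_image_iff.1 hF
    obtain ⟨a, ha⟩ := hfip F
    refine ⟨a ∘ e.symm, fun ψ hψ => ?_⟩
    obtain ⟨i, hi, rfl⟩ := Finset.mem_image.1 hψ
    rw [hrealize, Function.comp_assoc, e.symm_comp_self]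
    exact Set.mem_iInter₂.1 ha i hi
  exact ⟨a ∘ e, Set.mem_iInter.2 fun i => (hrealize i a).1 (ha _ ⟨i, rfl⟩)⟩

variable {α : Type} [Finite α] {p q : GlobalType L M α} {X Y : Set (α → M)}

namespace GlobalType

omit [Finite α] in
theorem Contains.definable (hX : p.Contains X) : (Set.univ : Set M).Definable L X := by
  obtain ⟨φ, -, hφ⟩ := hX
  exact definable_univ_iff.2 ⟨φ, hφ⟩

theorem exists_ultrafilter (p : GlobalType L M α) :
    ∃ 𝒰 : Ultrafilter (α → M), ∀ φ : L[[M]].Formula α,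
      φ ∈ p.formulas ↔ {x : α → M | φ.Realize x} ∈ 𝒰 := by
  obtain ⟨W, v, rfl⟩ := Theory.exists_modelType_is_realized_in _ p
  have hv (φ : L[[M]].Formula α) :
      φ ∈ GlobalType.formulas (Theory.typeOf (L[[M]].completeTheory M) v) ↔ φ.Realize v :=
    Theory.CompleteType.formula_mem_typeOf (T := L[[M]].completeTheory M)
  obtain ⟨𝒰, h𝒰⟩ := Ultrafilter.exists_ultrafilter_of_finite_inter_nonempty
    ((fun φ : L[[M]].Formula α => {x : α → M | φ.Realize x}) '' {φ | φ.Realize v}) fun T hT => by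
      choose φ hφ hφT using hT
      let ψ : L[[M]].Formula α := Formula.iInf fun X : T => φ X.2
      have hψ : ψ.Realize v := Formula.realize_iInf.2 fun X => hφ X.2
      obtain ⟨x, hx⟩ := exists_realize_of_model_completeTheory (M := M) hψ
      refine ⟨x, fun X hX => ?_⟩
      rw [← hφT hX]
      exact Formula.realize_iInf.1 hx ⟨X, hX⟩
  refine ⟨𝒰, fun φ => (hv φ).trans ⟨fun h => h𝒰 ⟨φ, h, rfl⟩, fun h => ?_⟩⟩
  by_contra hφ
  refine Ultrafilter.compl_notMem_iff.2 h (h𝒰 ⟨φ.not, hφ, ?_⟩)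
  ext
  simp

/-- An ultrafilter whose definable members are the sets contained in `p`; it is not determined by
this property. -/
noncomputable def ultrafilter (p : GlobalType L M α) : Ultrafilter (α → M) :=
  p.exists_ultrafilter.choose

theorem mem_formulas_iff_mem_ultrafilter {φ : L[[M]].Formula α} :
    φ ∈ p.formulas ↔ {x : α → M | φ.Realize x} ∈ p.ultrafilter :=
  p.exists_ultrafilter.choose_spec φ

theorem mem_formulas_iff_contains {φ : L[[M]].Formula α} :
    φ ∈ p.formulas ↔ p.Contains {x | φ.Realize x} := by
  refine ⟨fun hφ => ⟨φ, hφ, rfl⟩, fun ⟨ψ, hψ, hψφ⟩ => ?_⟩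
  rwa [mem_formulas_iff_mem_ultrafilter, ← hψφ, ← mem_formulas_iff_mem_ultrafilter]

theorem contains_iff_mem_ultrafilter (hX : (Set.univ : Set M).Definable L X) :
    p.Contains X ↔ X ∈ p.ultrafilter := by
  obtain ⟨φ, rfl⟩ := definable_univ_iff.1 hX
  rw [← mem_formulas_iff_contains, mem_formulas_iff_mem_ultrafilter]

theorem Contains.inter (hX : p.Contains X) (hY : p.Contains Y) : p.Contains (X ∩ Y) := by
  rw [contains_iff_mem_ultrafilter (hX.definable.inter hY.definable)]
  exact Filter.inter_mem ((contains_iff_mem_ultrafilter hX.definable).1 hX)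
    ((contains_iff_mem_ultrafilter hY.definable).1 hY)

theorem Contains.mono (hX : p.Contains X) (hY : (Set.univ : Set M).Definable L Y) (hXY : X ⊆ Y) :
    p.Contains Y :=
  (contains_iff_mem_ultrafilter hY).2 <|
    Filter.mem_of_superset ((contains_iff_mem_ultrafilter hX.definable).1 hX) hXY

theorem contains_compl_iff (hX : (Set.univ : Set M).Definable L X) :
    p.Contains Xᶜ ↔ ¬ p.Contains X := by
  rw [contains_iff_mem_ultrafilter hX, contains_iff_mem_ultrafilter hX.compl,
    Ultrafilter.compl_mem_iff_notMem]

theorem eq_of_contains_imp (h : ∀ X, q.Contains X → p.Contains X) : q = p := by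
  have hle : (q : Set L[[M]][[α]].Sentence) ⊆ p := fun s hs => by
    obtain ⟨φ, rfl⟩ := Formula.equivSentence.surjective s
    exact mem_formulas_iff_contains.2 (h _ ⟨φ, hs, rfl⟩)
  refine SetLike.ext fun s => ⟨fun hs => hle hs, fun hs => ?_⟩
  by_contra hsq
  exact (p.not_mem_iff s).1 (hle ((q.not_mem_iff s).2 hsq)) hs

theorem realizesOver_iff {a : α → M} :
    RealizesOver p.formulas B a ↔ ∀ X, B.Definable L X → p.Contains X → a ∈ X := by
  constructor
  · rintro h X ⟨φ, rfl⟩ hX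
    refine h φ (mem_formulas_iff_contains.2 ?_)
    simpa only [LHom.realize_onFormula] using hX
  · intro h φ hφ
    refine h {x | φ.Realize x} ⟨φ, rfl⟩ ?_
    simpa only [LHom.realize_onFormula] using mem_formulas_iff_contains.1 hφ

end GlobalType

theorem RealizesOver.mono {a : α → M} (ha : RealizesOver p.formulas C a) (hBC : B ⊆ C) :
    RealizesOver p.formulas B a :=
  GlobalType.realizesOver_iff.2 fun X hX =>
    GlobalType.realizesOver_iff.1 ha X (hX.mono hBC)

theorem RealizesOver.mem_iff {a : α → M} (ha : RealizesOver p.formulas B a)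
    (hX : B.Definable L X) : a ∈ X ↔ p.Contains X := by
  refine ⟨fun haX => ?_, GlobalType.realizesOver_iff.1 ha X hX⟩
  by_contra hpX
  have hcompl := (GlobalType.contains_compl_iff (hX.mono (Set.subset_univ _))).2 hpX
  exact GlobalType.realizesOver_iff.1 ha _ hX.compl hcompl haX

theorem IsSaturated.exists_realizesOver {κ : Cardinal.{w}} (hM : IsSaturated L M κ)
    (hB : #B < κ) (p : GlobalType L M α) : ∃ a, RealizesOver p.formulas B a := by
  obtain ⟨a, ha⟩ := hM.nonempty_iInter hB
    (X := fun X : {X : Set (α → M) // B.Definable L X ∧ p.Contains X} => X.1)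
    (fun X => X.2.1) fun F => by
      refine p.ultrafilter.nonempty_of_mem ((Filter.biInter_finset_mem F).2 fun X _ => ?_)
      exact (GlobalType.contains_iff_mem_ultrafilter X.2.2.definable).1 X.2.2
  exact ⟨a, GlobalType.realizesOver_iff.2 fun X hX hpX => Set.mem_iInter.1 ha ⟨X, hX, hpX⟩⟩

end Types

section Definability

variable {L : FirstOrder.Language.{u, v}} {M : Type w} [L.Structure M] {A B : Set M}
  {α β γ : Type*}

/-- The member of the family `X` of subsets of `α → M` at the parameter `y`. -/
def fiber (X : Set (α ⊕ β → M)) (y : β → M) : Set (α → M) :=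
  {x | Sum.elim x y ∈ X}

theorem definable_fiber [Finite α] [Finite β] {X : Set (α ⊕ β → M)} (hX : A.Definable L X)
    {y : β → M} (hy : ∀ j, y j ∈ A) : A.Definable L (fiber X y) :=
  hX.preimage_map (F := fun x => Sum.elim x y) <| Sum.rec (fun _ => Set.DefinableFun.proj L)
    fun j => L.definableFun_const _ (hy j)

theorem definable_exists_mem [Finite γ] {S : Set (γ → M)} (hS : A.Definable L S)
    {X : Set (β ⊕ γ → M)} (hX : A.Definable L X) :
    A.Definable L {v : β → M | ∃ x : S, Sum.elim v x ∈ X} := by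
  convert! ((hS.preimage_comp Sum.inr).inter hX).exists_of_finite using 1
  ext v
  simp

theorem definable_forall_mem [Finite γ] {S : Set (γ → M)} (hS : A.Definable L S)
    {X : Set (β ⊕ γ → M)} (hX : A.Definable L X) :
    A.Definable L {v : β → M | ∀ x : S, Sum.elim v x ∈ X} := by
  convert! (definable_exists_mem hS hX.compl).compl using 1
  ext v
  simp

theorem definable_exists_tuple [Finite γ] {S : Set (γ → M)} (hS : A.Definable L S) (k : ℕ)
    {X : Set (β ⊕ Fin k × γ → M)} (hX : A.Definable L X) :
    A.Definable L {v : β → M | ∃ g : Fin k → S, Sum.elim v (fun t => (g t.1 : γ → M) t.2) ∈ X} := by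
  have hpow : A.Definable L {u : Fin k × γ → M | ∀ i, (fun j => u (i, j)) ∈ S} := by
    rw [Set.ofPred_forall]
    exact Set.definable_iInter_of_finite fun i => hS.preimage_comp (Prod.mk i)
  convert! definable_exists_mem hpow hX using 1
  ext v
  exact ⟨fun ⟨g, hg⟩ => ⟨⟨_, fun i => (g i).2⟩, hg⟩, fun ⟨u, hu⟩ => ⟨fun i => ⟨_, u.2 i⟩, hu⟩⟩

end Definability

section DefinableGroups

variable {L : FirstOrder.Language.{u, v}} {M : Type w} [L.Structure M] {A B : Set M} {m : ℕ}
  {H : Set (Fin m → M)}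

/-- The subsets of `H` that are definable over `A`. -/
def definableSubsets (hH : A.Definable L H) : BooleanSubalgebra (Set H) where
  carrier := {X | A.Definable L (((↑) : H → Fin m → M) '' X)}
  supClosed' X hX Y hY := by
    change A.Definable L (_ '' (X ∪ Y))
    rw [Set.image_union]
    exact hX.union hY
  infClosed' X hX Y hY := by
    change A.Definable L (_ '' (X ∩ Y))
    rw [Set.image_inter Subtype.val_injective]
    exact hX.inter hY
  compl_mem' {X} hX := by
    change A.Definable L (_ '' Xᶜ)
    rw [Set.image_compl_eq_range_sdiff_image Subtype.val_injective, Subtype.range_coe]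
    exact hH.sdiff hX
  bot_mem' := by
    change A.Definable L (_ '' ∅)
    rw [Set.image_empty]
    exact Set.definable_empty

theorem mem_definableSubsets_iff (hH : A.Definable L H) {X : Set H} :
    X ∈ definableSubsets hH ↔ A.Definable L (((↑) : H → Fin m → M) '' X) :=
  Iff.rfl

theorem preimage_val_mem_definableSubsets (hH : A.Definable L H) {X : Set (Fin m → M)}
    (hX : A.Definable L X) : (↑) ⁻¹' X ∈ definableSubsets hH := by
  rw [mem_definableSubsets_iff, Subtype.image_preimage_val]
  exact hH.inter hX

/-- The family `R` of subsets of `H`, indexed by `H`, as a family of sets of `m`-tuples in the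
sense of `fiber`. -/
def familyGraph (R : H → Set H) : Set (Fin m ⊕ Fin m → M) :=
  {v | ∃ h g : H, Sum.elim h g = v ∧ h ∈ R g}

theorem elim_mem_familyGraph_iff {R : H → Set H} {h g : H} :
    Sum.elim (h : Fin m → M) g ∈ familyGraph R ↔ h ∈ R g := by
  refine ⟨fun ⟨h', g', hv, hR⟩ => ?_, fun hR => ⟨h, g, rfl, hR⟩⟩
  obtain ⟨hh, hg⟩ := Sum.elim_eq_iff.1 hv
  rwa [← Subtype.ext hh, ← Subtype.ext hg]

theorem definable_familyGraph_symmDiff {R S : H → Set H} (hR : A.Definable L (familyGraph R))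
    (hS : A.Definable L (familyGraph S)) : A.Definable L (familyGraph fun g => R g ∆ S g) := by
  convert! (hR.sdiff hS).union (hS.sdiff hR) using 1
  refine Set.Subset.antisymm ?_ ?_
  · rintro _ ⟨h, g, rfl, hRS⟩
    simpa only [Set.mem_union, Set.mem_sdiff, elim_mem_familyGraph_iff, Set.mem_symmDiff] using hRS
  · rintro _ (⟨⟨h, g, rfl, hR⟩, hS⟩ | ⟨⟨h, g, rfl, hS⟩, hR⟩)
    · exact ⟨h, g, rfl, .inl ⟨hR, fun h => hS (elim_mem_familyGraph_iff.2 h)⟩⟩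
    · exact ⟨h, g, rfl, .inr ⟨hS, fun h => hR (elim_mem_familyGraph_iff.2 h)⟩⟩

theorem definable_familyGraph_const (hH : A.Definable L H) {X : Set H}
    (hX : X ∈ definableSubsets hH) : A.Definable L (familyGraph fun _ => X) := by
  convert! (hX.preimage_comp Sum.inl).inter (hH.preimage_comp Sum.inr) using 1
  ext v
  constructor
  · rintro ⟨h, g, rfl, hh⟩
    exact ⟨⟨h, hh, rfl⟩, g.2⟩
  · rintro ⟨⟨h, hh, hv⟩, hg⟩
    exact ⟨h, ⟨_, hg⟩, by rw [hv, Sum.elim_comp_inl_inr], hh⟩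

namespace IsDefinableGroup

variable [Group H]

theorem mono (hH : IsDefinableGroup L H A) (hAB : A ⊆ B) : IsDefinableGroup L H B :=
  ⟨hH.carrier.mono hAB, hH.mul.mono hAB⟩

theorem definable_mem_smul {β : Type*} (hH : IsDefinableGroup L H A) (a b : Fin m → β)
    {X : Set (β ⊕ Fin m → M)} (hX : A.Definable L X) :
    A.Definable L {v : β → M | ∃ g h : H, v ∘ a = g ∧ v ∘ b = h ∧
      h ∈ g • {x : H | Sum.elim v x ∈ X}} := by
  convert! definable_exists_mem hH.carrier ((hH.mul.preimage_comp
    fun t => (![Sum.inl ∘ a, Sum.inr, Sum.inl ∘ b] : Fin 3 → Fin m → β ⊕ Fin m) t.1 t.2).inter hX)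
    using 1
  ext v
  constructor
  · rintro ⟨g, -, hg, hh, x, hx, rfl⟩
    exact ⟨x, ⟨g, x, hg, rfl, hh⟩, hx⟩
  · rintro ⟨x, ⟨g, y, hg, hxy, hh⟩, hx⟩
    obtain rfl : x = y := Subtype.ext hxy
    exact ⟨g, g * x, hg, hh, x, hx, rfl⟩

theorem definable_familyGraph_smul (hH : IsDefinableGroup L H A) {X : Set H}
    (hX : X ∈ definableSubsets hH.carrier) : A.Definable L (familyGraph fun g => g • X) := by
  convert! hH.definable_mem_smul (β := Fin m ⊕ Fin m) Sum.inr Sum.inl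
    (hX.preimage_comp Sum.inr) using 1
  ext v
  constructor
  · rintro ⟨_, g, rfl, x, hx, rfl⟩
    exact ⟨g, g * x, rfl, rfl, x, ⟨x, hx, rfl⟩, rfl⟩
  · rintro ⟨g, _, hg, hh, x, ⟨y, hy, hyx⟩, rfl⟩
    obtain rfl : y = x := Subtype.ext hyx
    refine ⟨g * y, g, ?_, y, hy, rfl⟩
    rw [← Sum.elim_comp_inl_inr v, hg, hh]
    rfl

theorem smul_mem_definableSubsets (hH : IsDefinableGroup L H A) {X : Set H}
    (hX : X ∈ definableSubsets hH.carrier) {g : H} (hg : ∀ j, (g : Fin m → M) j ∈ A) :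
    g • X ∈ definableSubsets hH.carrier := by
  convert! preimage_val_mem_definableSubsets hH.carrier
    (definable_fiber (hH.definable_familyGraph_smul hX) hg) using 1
  ext h
  exact (elim_mem_familyGraph_iff (R := fun g => g • X)).symm

theorem smul_inv_mem_definableSubsets (hH : IsDefinableGroup L H A) {X : Set H}
    (hX : X ∈ definableSubsets hH.carrier) {g : H} (hg : ∀ j, (g : Fin m → M) j ∈ A) :
    g • X⁻¹ ∈ definableSubsets hH.carrier := by
  convert! preimage_val_mem_definableSubsets hH.carrier
    (definable_fiber ((hH.definable_familyGraph_smul hX).preimage_comp Sum.swap) hg) using 1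
  ext h
  rw [mem_smul_inv_iff, ← elim_mem_familyGraph_iff (R := fun g => g • X), ← Sum.elim_swap]
  rfl

theorem definable_exists_cover (hH : IsDefinableGroup L H A) {β : Type*} (k : ℕ)
    {X : Set (Fin m ⊕ β → M)} (hX : A.Definable L X) :
    A.Definable L {y : β → M | ∃ g : Fin k → H, ∀ h : H, ∃ i,
      h ∈ g i • (((↑) : H → Fin m → M) ⁻¹' fiber X y)} := by
  have hcover (i : Fin k) := hH.definable_mem_smul (β := (β ⊕ Fin k × Fin m) ⊕ Fin m)
    (Sum.inl ∘ Sum.inr ∘ Prod.mk i) Sum.inr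
    (hX.preimage_comp (Sum.elim Sum.inr (Sum.inl ∘ Sum.inl ∘ Sum.inl)))
  convert! definable_exists_tuple hH.carrier k <|
    definable_forall_mem hH.carrier (Set.definable_iUnion_of_finite hcover) using 1
  ext y
  simp only [Set.mem_ofPred_eq, Set.mem_iUnion]
  refine exists_congr fun g => forall_congr' fun h => exists_congr fun i => ?_
  simp only [Set.mem_preimage, Sum.comp_elim, ← Function.comp_assoc, Sum.elim_comp_inl,
    Sum.elim_comp_inr]
  constructor
  · exact fun hh => ⟨g i, h, rfl, rfl, hh⟩
  · rintro ⟨g', h', hg, hh, hh'⟩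
    obtain rfl : g i = g' := Subtype.ext hg
    obtain rfl : h = h' := Subtype.ext hh
    exact hh'

end IsDefinableGroup

end DefinableGroups

section SmallSets

variable {L : FirstOrder.Language.{u, v}} {M : Type w} [L.Structure M] {κ : Cardinal.{w}}
  {A B : Set M} {m : ℕ} {H : Set (Fin m → M)}

theorem mk_union_lt (hκ : ℵ₀ ≤ κ) (hA : #A < κ) (hB : #B < κ) : #(A ∪ B : Set M) < κ :=
  (mk_union_le A B).trans_lt (add_lt_of_lt hκ hA hB)

theorem mk_union_lt_of_finite (hκ : ℵ₀ ≤ κ) (hA : #A < κ) (hB : B.Finite) :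
    #(A ∪ B : Set M) < κ :=
  mk_union_lt hκ hA ((lt_aleph0_iff_set_finite.2 hB).trans_le hκ)

/-- The points of `H` with coordinates in `N`. -/
def points (H : Set (Fin m → M)) (N : Set M) : Set H :=
  {x | ∀ j, (x : Fin m → M) j ∈ N}

theorem mk_points_lt (hκ : ℵ₀ ≤ κ) (hA : #A < κ) : #(points H A) < κ := by
  have hinj : Function.Injective fun (x : points H A) (j : Fin m) => (⟨_, x.2 j⟩ : A) :=
    fun x y hxy => Subtype.ext <| Subtype.ext <| funext fun j =>
      congrArg Subtype.val (congrFun hxy j)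
  refine (mk_le_of_injective hinj).trans_lt ?_
  rw [mk_arrow, mk_fin, lift_natCast, lift_uzero, power_natCast]
  rcases lt_or_ge #A ℵ₀ with hfin | hinf
  · exact (power_lt_aleph0 hfin natCast_lt_aleph0).trans_le hκ
  · exact (power_nat_le hinf).trans_lt hA

theorem IsDefinableGroup.exists_small_definable [Group H] (hκ : ℵ₀ ≤ κ) (hA : #A < κ)
    (hH : IsDefinableGroup L H A) {X : Set H}
    (hX : X ∈ definableSubsets (hH.mono (Set.subset_univ A)).carrier) :
    ∃ B : Set M, #B < κ ∧ ∃ hHB : IsDefinableGroup L H B, X ∈ definableSubsets hHB.carrier := by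
  obtain ⟨B, -, hB⟩ := Set.definable_iff_finitely_definable.1 hX
  exact ⟨A ∪ B, mk_union_lt_of_finite hκ hA B.finite_toSet, hH.mono Set.subset_union_left,
    hB.mono Set.subset_union_right⟩

end SmallSets

section Generics

variable {L : FirstOrder.Language.{u, v}} {M : Type w} [L.Structure M] {κ : Cardinal.{w}}
  {A B N : Set M} {m : ℕ} {H : Set (Fin m → M)} {p q : GlobalType L M (Fin m)}

/-- The restriction to `H` of the ultrafilter chosen for `p`. -/
noncomputable def GlobalType.ultrafilterOn (p : GlobalType L M (Fin m)) (hp : p.Contains H) :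
    Ultrafilter H :=
  p.ultrafilter.comap Subtype.val_injective <| by
    rw [Subtype.range_coe]
    exact (GlobalType.contains_iff_mem_ultrafilter hp.definable).1 hp

theorem GlobalType.mem_ultrafilterOn_iff (hp : p.Contains H) {X : Set H}
    (hX : X ∈ definableSubsets hp.definable) :
    X ∈ p.ultrafilterOn hp ↔ p.Contains ((↑) '' X) := by
  rw [contains_iff_mem_ultrafilter hX, ultrafilterOn, Ultrafilter.mem_comap]

variable [Group H]

theorem IsDefinableGroup.exists_finset_smul_inter_nonempty (hκ : ℵ₀ ≤ κ)
    (hsat : IsSaturated L M κ) (hA : #A < κ) (hH : IsDefinableGroup L H A) (hN : #N < κ)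
    {X : Set H} (hX : X ∈ definableSubsets (hH.mono (Set.subset_univ A)).carrier)
    (hmeet : ∀ g : H, (g • X ∩ points H N).Nonempty) :
    ∃ F : Finset H, ∀ g : H, (g • X ∩ F).Nonempty := by
  by_contra! hcon
  obtain ⟨B, hB, hHB, hXB⟩ := hH.exists_small_definable hκ hA hX
  have hHBN := hHB.mono (Set.subset_union_left (t := N))
  obtain ⟨a, ha⟩ := hsat.nonempty_iInter (mk_union_lt hκ hB hN)
    (X := fun n : points H N => (((↑) : H → Fin m → M) '' ((n : H) • X⁻¹)ᶜ))
    (fun n => (mem_definableSubsets_iff hHBN.carrier).1 <| BooleanSubalgebra.compl_mem <|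
      hHBN.smul_inv_mem_definableSubsets (hXB.mono Set.subset_union_left) fun j => .inr (n.2 j))
    fun F => by
      classical
      obtain ⟨g, hg⟩ := hcon (F.image (↑))
      refine ⟨g, Set.mem_iInter₂.2 fun n hn => ⟨g, fun hgn => ?_, rfl⟩⟩
      exact hg.subset ⟨mem_smul_inv_iff.1 hgn, Finset.mem_coe.2 (Finset.mem_image_of_mem _ hn)⟩
  obtain ⟨n, -, hn⟩ := hmeet 1
  obtain ⟨g, -, rfl⟩ := Set.mem_iInter.1 ha ⟨n, hn⟩
  obtain ⟨n, hng, hn⟩ := hmeet g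
  obtain ⟨g', hg', hgg'⟩ := Set.mem_iInter.1 ha ⟨n, hn⟩
  obtain rfl : g' = g := Subtype.ext hgg'
  exact hg' (mem_smul_inv_iff.2 hng)

theorem IsDefinableGroup.isFSG (hκ : ℵ₀ ≤ κ) (hsat : IsSaturated L M κ) (hA : #A < κ)
    (hH : IsDefinableGroup L H A) (hp : p.Contains H) (hN : #N < κ)
    (hfs : ∀ g : H, FinitelySatisfiableIn (translate L H g p) N) :
    IsFSG (definableSubsets hp.definable) (p.ultrafilterOn hp) (points H N) where
  smul_mem g X hX := (hH.mono (Set.subset_univ A)).smul_mem_definableSubsets hX fun _ => trivial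
  inv_mem {X} hX := by
    simpa using (hH.mono (Set.subset_univ A)).smul_inv_mem_definableSubsets hX (g := 1)
      fun _ => trivial
  inter_nonempty {X g} hX hg := by
    obtain ⟨φ, hφ⟩ := definable_univ_iff.1 hX
    have hφp : φ ∈ translate L H g⁻¹ p := by
      refine (congrArg p.Contains ?_).mp ((GlobalType.mem_ultrafilterOn_iff hp
        ((hH.mono (Set.subset_univ A)).smul_mem_definableSubsets hX fun _ => trivial)).1 hg)
      ext x
      rw [Subtype.coe_image, Set.mem_ofPred_eq, Set.mem_ofPred_eq]
      refine exists_congr fun hx => ?_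
      rw [Set.mem_smul_set_iff_inv_smul_mem, smul_eq_mul, ← Set.mem_ofPred_eq (p := φ.Realize),
        hφ, Subtype.val_injective.mem_set_image]
    obtain ⟨a, haN, ha⟩ := hfs g⁻¹ {φ} (by simpa using hφp)
    obtain ⟨x, hx, rfl⟩ := hφ.subset (ha φ (Finset.mem_singleton_self φ))
    exact ⟨x, hx, haN⟩
  exists_finset hX hmeet := hH.exists_finset_smul_inter_nonempty hκ hsat hA hN hX hmeet

theorem isLeftGeneric_iff {X : Set (Fin m → M)} :
    IsLeftGeneric H X ↔ IsLeftSyndetic (((↑) : H → Fin m → M) ⁻¹' X) := by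
  refine exists_congr fun F => forall_congr' fun h => exists_congr fun f =>
    and_congr_right fun _ => exists_congr fun x => and_congr_right fun _ => eq_comm

omit [Group H] in
theorem definable_iInter_realize {ι : Type*} {X : ι → Set (Fin m → M)}
    (hX : ∀ i, B.Definable L (X i)) :
    ∃ S : Set (L[[B]].Formula (Fin m)), ⋂ i, X i = {x | ∀ φ ∈ S, φ.Realize x} := by
  choose φ hφ using hX
  refine ⟨Set.range φ, ?_⟩
  ext x
  simp [hφ]

theorem IsDefinableGroup.isTypeDefinable_of_mem_iff (hB : #B < κ) (hH : IsDefinableGroup L H B)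
    {R : H → Set H} (hR : B.Definable L (familyGraph R)) {K : Subgroup H}
    (hK : ∀ g, g ∈ K ↔ ¬ IsLeftSyndetic (R g)) : IsTypeDefinable L H κ K := by
  obtain ⟨S, hS⟩ := definable_iInter_realize fun k =>
    hH.carrier.sdiff (hH.definable_exists_cover k hR)
  refine ⟨B, hB, S, fun x => ?_⟩
  rw [← Set.mem_ofPred_eq (p := fun x => ∀ φ ∈ S, φ.Realize x), ← hS, ← Set.sdiff_iUnion,
    Set.mem_sdiff, ← exists_prop]
  refine exists_congr fun hx => ?_
  rw [hK, isLeftSyndetic_iff_exists_fin, Set.mem_iUnion]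
  have hfiber : ((↑) : H → Fin m → M) ⁻¹' fiber (familyGraph R) x = R ⟨x, hx⟩ := by
    ext h
    exact elim_mem_familyGraph_iff (g := ⟨x, hx⟩)
  simp only [Set.mem_ofPred_eq, hfiber]

theorem IsDefinableGroup.stabilizer_eq_top (hκ : κ.IsStrongLimit) (hA : #A < κ)
    (hH : IsDefinableGroup L H A) (hconn : IsAbsolutelyConnected L H κ) (hN : #N < κ)
    {𝒰 : Ultrafilter H} {hHM : (Set.univ : Set M).Definable L H}
    (h𝒰 : IsFSG (definableSubsets hHM) 𝒰 (points H N)) {X : Set H} (hX : X ∈ definableSubsets hHM) :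
    h𝒰.stabilizer hX = ⊤ := by
  obtain ⟨B, hB, hHB, hXB⟩ := hH.exists_small_definable hκ.aleph0_le hA hX
  have htype : IsTypeDefinable L H κ (h𝒰.stabilizer hX) :=
    hHB.isTypeDefinable_of_mem_iff hB (definable_familyGraph_symmDiff
      (definable_familyGraph_const hHB.carrier hXB) (hHB.definable_familyGraph_smul hXB))
      fun g => h𝒰.mem_stabilizer_iff hX
  exact hconn _ htype <| (h𝒰.mk_quotient_stabilizer_le hX).trans_lt <|
    hκ.isStrongPrelimit (mk_points_lt hκ.aleph0_le hN)

/-- The type `p` consists of all the left generic definable sets, and these are closed under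
inversion. -/
structure ConsistsOfGenerics (L : FirstOrder.Language.{u, v}) [L.Structure M] (H : Set (Fin m → M))
    [Group H] (p : GlobalType L M (Fin m)) : Prop where
  contains_iff : ∀ {X : Set (Fin m → M)}, (Set.univ : Set M).Definable L X →
    (p.Contains X ↔ IsLeftGeneric H X)
  contains_inv : ∀ {X : Set H}, p.Contains ((↑) '' X) → p.Contains ((↑) '' X⁻¹)

theorem HasFSG.exists_consistsOfGenerics (hfsg : HasFSG L H κ) (hκ : κ.IsStrongLimit)
    (hsat : IsSaturated L M κ) (hA : #A < κ) (hH : IsDefinableGroup L H A)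
    (hconn : IsAbsolutelyConnected L H κ) :
    ∃ p : GlobalType L M (Fin m), ConsistsOfGenerics L H p := by
  obtain ⟨p, hp, N, hN, hfs⟩ := hfsg
  have h𝒰 := hH.isFSG hκ.aleph0_le hsat hA hp hN hfs
  have hmem {X : Set H} (hX : X ∈ definableSubsets hp.definable) :
      p.Contains ((↑) '' X) ↔ IsLeftSyndetic X := by
    rw [← GlobalType.mem_ultrafilterOn_iff hp hX]
    exact h𝒰.mem_iff_isLeftSyndetic hX (hH.stabilizer_eq_top hκ hA hconn hN h𝒰 hX)
  refine ⟨p, fun {X} hX => ?_, fun {X} hX => ?_⟩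
  · rw [isLeftGeneric_iff, ← hmem (preimage_val_mem_definableSubsets _ hX),
      Subtype.image_preimage_val]
    exact ⟨fun h => hp.inter h, fun h => h.mono hX Set.inter_subset_right⟩
  · have hXD : X ∈ definableSubsets hp.definable := hX.definable
    exact (hmem (h𝒰.inv_mem hXD)).2 (h𝒰.isLeftSyndetic_inv hXD ((hmem hXD).1 hX))

namespace ConsistsOfGenerics

theorem contains_carrier (hp : ConsistsOfGenerics L H p) (hH : IsDefinableGroup L H A) :
    p.Contains H :=
  (hp.contains_iff (hH.carrier.mono (Set.subset_univ A))).2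
    ⟨{1}, fun h => ⟨1, Finset.mem_singleton_self 1, h, h.2, (one_mul h).symm⟩⟩

theorem isGenericType (hp : ConsistsOfGenerics L H p) (hH : IsDefinableGroup L H A) :
    IsGenericType L H p :=
  ⟨hp.contains_carrier hH, fun _ hφ =>
    (hp.contains_iff (definable_univ_iff.2 ⟨_, rfl⟩)).1 (GlobalType.mem_formulas_iff_contains.1 hφ)⟩

theorem eq_of_isGenericType (hp : ConsistsOfGenerics L H p) (hq : IsGenericType L H q) : q = p := by
  refine GlobalType.eq_of_contains_imp fun X hX => (hp.contains_iff hX.definable).2 ?_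
  obtain ⟨φ, hφ, rfl⟩ := hX
  exact hq.2 φ hφ

theorem isInvariantOver (hp : ConsistsOfGenerics L H p) (hH : IsDefinableGroup L H A) :
    p.IsInvariantOver A := by
  intro k φ c c' hcc'
  have hφ : A.Definable L {v : Fin m ⊕ Fin k → M | φ.Realize v} :=
    (Set.empty_definable_iff.2 ⟨φ, rfl⟩).mono (Set.empty_subset A)
  have hcover (y : Fin k → M) : p.Contains (fiber {v | φ.Realize v} y) ↔
      ∃ j, ∃ g : Fin j → H, ∀ h : H, ∃ i,
        h ∈ g i • (((↑) : H → Fin m → M) ⁻¹' fiber {v | φ.Realize v} y) := by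
    rw [hp.contains_iff (definable_fiber (hφ.mono (Set.subset_univ A)) fun _ => trivial),
      isLeftGeneric_iff, isLeftSyndetic_iff_exists_fin]
  exact (hcover c).trans <| (exists_congr fun j =>
    hcc'.mem_iff (hH.definable_exists_cover j hφ)).trans (hcover c').symm

theorem contains_image_iff (hp : ConsistsOfGenerics L H p) {X : Set H}
    (hX : (Set.univ : Set M).Definable L (((↑) : H → Fin m → M) '' X)) :
    p.Contains ((↑) '' X) ↔ IsLeftSyndetic X := by
  rw [hp.contains_iff hX, isLeftGeneric_iff, Set.preimage_image_eq _ Subtype.val_injective]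

theorem contains_smul (hp : ConsistsOfGenerics L H p) (hH : IsDefinableGroup L H A) {X : Set H}
    (hX : p.Contains ((↑) '' X)) (g : H) : p.Contains ((↑) '' (g • X)) := by
  rw [hp.contains_image_iff <|
    (hH.mono (Set.subset_univ A)).smul_mem_definableSubsets hX.definable fun _ => trivial]
  exact ((hp.contains_image_iff hX.definable).1 hX).smul g

theorem exists_mul_eq (hp : ConsistsOfGenerics L H p) (hκ : ℵ₀ ≤ κ) (hsat : IsSaturated L M κ)
    (hH : IsDefinableGroup L H A) (hA : #A < κ) (x : H) :
    ∃ a b : H, a * b = x ∧ RealizesOver p.formulas A (a : Fin m → M) ∧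
      RealizesOver p.formulas A (b : Fin m → M) := by
  have hHx := hH.mono (Set.subset_union_left (t := Set.range (x : Fin m → M)))
  obtain ⟨a, ha⟩ :=
    hsat.exists_realizesOver (mk_union_lt_of_finite hκ hA (Set.finite_range (x : Fin m → M))) p
  lift a to H using GlobalType.realizesOver_iff.1 ha H hHx.carrier (hp.contains_carrier hH)
  refine ⟨a, a⁻¹ * x, mul_inv_cancel_left a x, ha.mono Set.subset_union_left,
    GlobalType.realizesOver_iff.2 fun X hX hpX => ?_⟩
  have hpXH : p.Contains (((↑) : H → Fin m → M) '' ((↑) ⁻¹' X)) := by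
    rw [Subtype.image_preimage_val]
    exact (hp.contains_carrier hH).inter hpX
  have hax := GlobalType.realizesOver_iff.1 ha _
    (hHx.smul_inv_mem_definableSubsets (preimage_val_mem_definableSubsets hHx.carrier
      (hX.mono Set.subset_union_left)) fun j => .inr ⟨j, rfl⟩)
    (hp.contains_smul hH (hp.contains_inv hpXH) x)
  rwa [Subtype.val_injective.mem_set_image, mem_smul_inv_iff,
    Set.mem_smul_set_iff_inv_smul_mem] at hax

end ConsistsOfGenerics

end Generics

section Morley

variable {L : FirstOrder.Language.{u, v}} {M : Type w} [L.Structure M] {κ : Cardinal.{w}}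
  {A : Set M} {m n : ℕ} {p : GlobalType L M (Fin m)}

theorem exists_formula_fiber_eq {α δ : Type*} [Finite δ] {X : Set (α ⊕ δ → M)}
    (hX : A.Definable L X) :
    ∃ (k : ℕ) (φ : L.Formula (α ⊕ Fin k)) (c : Fin k → A ⊕ δ), ∀ y : δ → M,
      fiber X y = {x | φ.Realize (Sum.elim x fun i => Sum.elim (↑) y (c i))} := by
  classical
  obtain ⟨A₀, hA₀, hX⟩ := Set.definable_iff_finitely_definable.1 hX
  obtain ⟨φ, rfl⟩ := Set.definable_iff_exists_formula_sum.1 hX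
  obtain ⟨k, ⟨e⟩⟩ := Finite.exists_equiv_fin ((A₀ : Set M) ⊕ δ)
  refine ⟨k, φ.relabel (Sum.elim (Sum.inr ∘ e ∘ Sum.inl) (Sum.map id (e ∘ Sum.inr))),
    Sum.map (Set.inclusion hA₀) id ∘ e.symm, fun y => ?_⟩
  ext x
  simp only [fiber, Set.mem_ofPred_eq, Formula.realize_relabel]
  refine iff_of_eq (congrArg φ.Realize (funext ?_))
  rintro (a | a | d) <;> simp

theorem GlobalType.IsInvariantOver.contains_fiber_iff {α : Type} {p : GlobalType L M α}
    (hp : p.IsInvariantOver A) {δ : Type*} [Finite δ] {X : Set (α ⊕ δ → M)}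
    (hX : A.Definable L X) {y y' : δ → M}
    (hyy' : ∀ Y : Set (δ → M), A.Definable L Y → (y ∈ Y ↔ y' ∈ Y)) :
    p.Contains (fiber X y) ↔ p.Contains (fiber X y') := by
  obtain ⟨k, φ, c, hφ⟩ := exists_formula_fiber_eq hX
  rw [hφ, hφ]
  refine hp k φ _ _ fun ψ => hyy' {y | ψ.Realize fun i => Sum.elim Subtype.val y (c i)} ?_
  have hψ : A.Definable L {v | ψ.Realize v} := ⟨ψ, rfl⟩
  have hcoord : ∀ s : A ⊕ δ, A.DefinableFun L fun y : δ → M => Sum.elim Subtype.val y s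
    | .inl a => L.definableFun_const _ a.2
    | .inr _ => Set.DefinableFun.proj L
  exact hψ.preimage_map (F := fun y i => Sum.elim Subtype.val y (c i)) fun i => hcoord (c i)

theorem finite_setOf_coordinates (a : Fin n → Fin m → M) : {b | ∃ j t, b = a j t}.Finite := by
  refine (Set.finite_range fun t : Fin n × Fin m => a t.1 t.2).subset ?_
  rintro _ ⟨j, t, rfl⟩
  exact ⟨(j, t), rfl⟩

namespace GlobalType.IsMorleySequence

theorem mono {B : Set M} {a : Fin n → Fin m → M} (ha : p.IsMorleySequence B a) (hAB : A ⊆ B) :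
    p.IsMorleySequence A a :=
  fun i => (ha i).mono (Set.union_subset_union_left _ hAB)

theorem castSucc {a : Fin (n + 1) → Fin m → M} (ha : p.IsMorleySequence A a) :
    p.IsMorleySequence A fun i => a i.castSucc := by
  intro i
  refine (ha i.castSucc).mono (Set.union_subset_union_right _ ?_)
  rintro b ⟨j, hj, t, rfl⟩
  exact ⟨j.castSucc, Fin.castSucc_lt_castSucc_iff.2 hj, t, rfl⟩

theorem snoc {a : Fin n → Fin m → M} {b : Fin m → M} (ha : p.IsMorleySequence A a)
    (hb : RealizesOver p.formulas (A ∪ {b | ∃ j t, b = a j t}) b) :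
    p.IsMorleySequence A (Fin.snoc a b : Fin (n + 1) → Fin m → M) := by
  intro i
  induction i using Fin.lastCases with
  | last =>
    rw [Fin.snoc_last]
    refine hb.mono (Set.union_subset_union_right _ ?_)
    rintro _ ⟨j, hj, t, rfl⟩
    obtain ⟨j, rfl⟩ := Fin.exists_castSucc_eq.2 hj.ne
    exact ⟨j, t, by rw [Fin.snoc_castSucc]⟩
  | cast i =>
    rw [Fin.snoc_castSucc]
    refine (ha i).mono (Set.union_subset_union_right _ ?_)
    rintro _ ⟨j, hj, t, rfl⟩
    obtain ⟨j, rfl⟩ := Fin.exists_castSucc_eq.2 (hj.trans_le (Fin.le_last _)).ne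
    exact ⟨j, Fin.castSucc_lt_castSucc_iff.1 hj, t, by rw [Fin.snoc_castSucc]⟩

theorem mem_iff_contains_fiber {a : Fin (n + 1) → Fin m → M} (ha : p.IsMorleySequence A a)
    {X : Set (Fin m ⊕ Fin n × Fin m → M)} (hX : A.Definable L X) :
    Sum.elim (a (Fin.last n)) (fun t => a t.1.castSucc t.2) ∈ X ↔
      p.Contains (fiber X fun t => a t.1.castSucc t.2) :=
  (ha (Fin.last n)).mem_iff (X := fiber X _) <|
    definable_fiber (hX.mono Set.subset_union_left) fun t =>
      .inr ⟨t.1.castSucc, Fin.castSucc_lt_last _, t.2, rfl⟩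

theorem mem_iff (hp : p.IsInvariantOver A) {a b : Fin n → Fin m → M} (ha : p.IsMorleySequence A a)
    (hb : p.IsMorleySequence A b) {X : Set (Fin n × Fin m → M)} (hX : A.Definable L X) :
    (fun t => a t.1 t.2) ∈ X ↔ (fun t => b t.1 t.2) ∈ X := by
  induction n with
  | zero => rw [Subsingleton.elim a b]
  | succ n ih =>
    let e (t : Fin (n + 1) × Fin m) : Fin m ⊕ Fin n × Fin m :=
      Fin.lastCases (.inl t.2) (fun i => .inr (i, t.2)) t.1
    have hlast (c : Fin (n + 1) → Fin m → M) : (fun t : Fin (n + 1) × Fin m => c t.1 t.2) =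
        Sum.elim (c (Fin.last n)) (fun t => c t.1.castSucc t.2) ∘ e := by
      ext ⟨i, t⟩
      induction i using Fin.lastCases <;> simp [e]
    have hXe := hX.preimage_comp e
    rw [hlast a, hlast b]
    exact (ha.mem_iff_contains_fiber hXe).trans <|
      (hp.contains_fiber_iff hXe fun Y hY => ih ha.castSucc hb.castSucc hY).trans
        (hb.mem_iff_contains_fiber hXe).symm

end GlobalType.IsMorleySequence

theorem IsSaturated.exists_isMorleySequence (hκ : ℵ₀ ≤ κ) (hsat : IsSaturated L M κ)
    (hA : #A < κ) (p : GlobalType L M (Fin m)) (n : ℕ) :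
    ∃ a : Fin n → Fin m → M, p.IsMorleySequence A a := by
  induction n with
  | zero => exact ⟨Fin.elim0, fun i => i.elim0⟩
  | succ n ih =>
    obtain ⟨a, ha⟩ := ih
    obtain ⟨b, hb⟩ := hsat.exists_realizesOver
      (mk_union_lt_of_finite hκ hA (finite_setOf_coordinates a)) p
    exact ⟨_, ha.snoc hb⟩

theorem GlobalType.IsMorleySequence.realizesOver_power (hκ : ℵ₀ ≤ κ) (hsat : IsSaturated L M κ)
    (hA : #A < κ) (hp : p.IsInvariantOver A) {a : Fin n → Fin m → M}
    (ha : p.IsMorleySequence A a) : RealizesOver (p.power A n) A (fun t => a t.1 t.2) := by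
  rintro φ ⟨B, hB, hφ⟩
  obtain ⟨b, hb⟩ := hsat.exists_isMorleySequence hκ (mk_union_lt_of_finite hκ hA hB) p n
  have hbφ := hφ b hb
  rw [LHom.realize_onFormula] at hbφ
  exact (ha.mem_iff hp (hb.mono Set.subset_union_left) (X := {x | φ.Realize x}) ⟨φ, rfl⟩).2 hbφ

theorem ConsistsOfGenerics.exists_mul_eq_and_snoc {H : Set (Fin m → M)} [Group H]
    (hp : ConsistsOfGenerics L H p) (hκ : ℵ₀ ≤ κ) (hsat : IsSaturated L M κ)
    (hH : IsDefinableGroup L H A) (hA : #A < κ) {g : Fin n → H}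
    (hg : p.IsMorleySequence A fun i => (g i : Fin m → M)) (x : H) :
    ∃ a b : H, a * b = x ∧
      p.IsMorleySequence A (fun i => ((Fin.snoc g a : Fin (n + 1) → H) i : Fin m → M)) ∧
      p.IsMorleySequence A (fun i => ((Fin.snoc g b : Fin (n + 1) → H) i : Fin m → M)) := by
  obtain ⟨a, b, rfl, ha, hb⟩ := hp.exists_mul_eq hκ hsat (hH.mono Set.subset_union_left)
    (mk_union_lt_of_finite hκ hA (finite_setOf_coordinates fun i => (g i : Fin m → M))) x
  have hsnoc (c : H) : (fun i => ((Fin.snoc g c : Fin (n + 1) → H) i : Fin m → M)) =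
      (Fin.snoc (fun i => (g i : Fin m → M)) (c : Fin m → M) : Fin (n + 1) → Fin m → M) := by
    ext i : 1
    induction i using Fin.lastCases <;> simp
  refine ⟨a, b, rfl, ?_, ?_⟩
  · rw [hsnoc]
    exact hg.snoc ha
  · rw [hsnoc]
    exact hg.snoc hb

end Morley

end MonsterGroup

theorem mainTheorem5_general {L : FirstOrder.Language.{u, v}} {M : Type w} [L.Structure M]
    (κ : Cardinal.{w}) (hκ : κ.IsStrongLimit) (hsat : MonsterGroup.IsSaturated L M κ)
    (A : Set M) (hA : #A < κ)
    {m : ℕ} (H : Set (Fin m → M)) [Group H] (hH : MonsterGroup.IsDefinableGroup L H A)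
    (hconn : MonsterGroup.IsAbsolutelyConnected L H κ)
    (hfsg : MonsterGroup.HasFSG L H κ) :
    ∃ p : MonsterGroup.GlobalType L M (Fin m),
      MonsterGroup.IsGenericType L H p ∧
      (∀ q : MonsterGroup.GlobalType L M (Fin m), MonsterGroup.IsGenericType L H q → q = p) ∧
      p.IsInvariantOver A ∧
      ∀ (n : ℕ), ∀ x ∈ (⊤ : Subgroup H).lowerCentralSeries n,
        ∃ l : List H, l.prod = x ∧
          ∀ y ∈ l, ∃ (c : H) (g : Fin (n + 1) → H),
            MonsterGroup.RealizesOver (p.power A (n + 1)) A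
              (fun t => (g t.1 : Fin m → M) t.2) ∧
            y = c⁻¹ * MonsterGroup.iteratedCommutator n g * c := by
  open MonsterGroup in
  obtain ⟨p, hp⟩ := hfsg.exists_consistsOfGenerics hκ hsat hA hH hconn
  have hinv := hp.isInvariantOver hH
  refine ⟨p, hp.isGenericType hH, fun q => hp.eq_of_isGenericType, hinv, fun n x hx => ?_⟩
  have hprod := mem_conjProducts_of_mem_lowerCentralSeries
    (S := fun n => {g : Fin n → H | p.IsMorleySequence A fun i => (g i : Fin m → M)})
    ⟨Fin.elim0, fun i => i.elim0⟩
    (fun n g hg h => hp.exists_mul_eq_and_snoc hκ.aleph0_le hsat hH hA hg h) hx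
  obtain ⟨l, rfl, hl⟩ := exists_list_of_mem_conjProducts hprod
  refine ⟨l, rfl, fun y hy => ?_⟩
  obtain ⟨c, _, ⟨g, hg, rfl⟩, rfl⟩ := hl y hy
  exact ⟨c, g, GlobalType.IsMorleySequence.realizesOver_power hκ.aleph0_le hsat hA hinv hg, rfl⟩

/-- The index is shifted: `(⊤ : Subgroup H).lowerCentralSeries n` is the term `Γ_{n+1}(H)`, with
`Γ_1(H) = H`, and `iteratedCommutator n` is `γ_{n+1}`. -/
theorem mainTheorem5 {L : FirstOrder.Language.{u, v}} {M : Type w} [L.Structure M] [Nonempty M]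
    (κ : Cardinal.{w}) (hM : MonsterGroup.IsMonster L M κ)
    (A : Set M) (hA : #A < κ)
    {m : ℕ} (H : Set (Fin m → M)) [Group H] (hH : MonsterGroup.IsDefinableGroup L H A)
    (hconn : MonsterGroup.IsAbsolutelyConnected L H κ)
    (hfsg : MonsterGroup.HasFSG L H κ) :
    ∃ p : MonsterGroup.GlobalType L M (Fin m),
      MonsterGroup.IsGenericType L H p ∧
      (∀ q : MonsterGroup.GlobalType L M (Fin m), MonsterGroup.IsGenericType L H q → q = p) ∧
      p.IsInvariantOver A ∧
      ∀ (n : ℕ), ∀ x ∈ (⊤ : Subgroup H).lowerCentralSeries n,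
        ∃ l : List H, l.prod = x ∧
          ∀ y ∈ l, ∃ (c : H) (g : Fin (n + 1) → H),
            MonsterGroup.RealizesOver (p.power A (n + 1)) A
              (fun t => (g t.1 : Fin m → M) t.2) ∧
            y = c⁻¹ * MonsterGroup.iteratedCommutator n g * c :=
  mainTheorem5_general κ hM.strongLimit hM.saturated A hA H hH hconn hfsg
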